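/- All tensor products of C*-algebras are maximal: for unital C*-algebras, $A\otimes B$ (and likewise a tensor product of any finite or countably infinite family) is the universal C*-algebra generated by commuting copies of the factors with a common unit. The full free product $A*P*\cdots*P$ is the universal C*-algebra generated by copies of the factors with no relations; in particular the units of the factors are not identified. A separable C*-algebra $A$ is semiprojective if, whenever $D$ is a C*-algebra, $(J_k)$ is an increasing sequence of closed two-sided ideals of $D$ and $J=\overline{\bigcup_k J_k}$, every *-homomorphism $\phi:A\to D/J$ lifts to a *-homomorphism $\psi:A\to D/J_k$ for some $k$. Let $A$ and $P$ be separable unital C*-algebras such that $P\cong P^{\otimes\infty}=\bigotimes_{k=1}^{\infty}P$, $A$ is semiprojective, and $A\otimes P\cong A$. Then for every $n\ge 1$ the canonical quotient map $$\pi:\;A*\underbrace{P*\cdots*P}_{n}\;\longrightarrow\;A\otimes P^{\otimes n}$$ (which sends each free factor identically onto the corresponding tensor factor) splits: there is a *-homomorphism $\sigma:A\otimes P^{\otimes n}\to A*P*\cdots*P$ with $\pi\circ\sigma=\mathrm{id}$. -/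

import Mathlib

open Filter Topology
open scoped ENNReal
universe u v

/-- A norm-closed two-sided ideal of a C⋆-algebra. -/
structure ClosedIdeal (D : Type u) [NonUnitalCStarAlgebra D] extends Submodule ℂ D where
  mul_mem_left' : ∀ (a : D) {x : D}, x ∈ carrier → a * x ∈ carrier
  mul_mem_right' : ∀ {x : D} (a : D), x ∈ carrier → x * a ∈ carrier
  isClosed' : IsClosed carrier

namespace ClosedIdeal

section Basic

variable {D : Type u} [NonUnitalCStarAlgebra D]

theorem isClosed (J : ClosedIdeal D) : IsClosed (J.toSubmodule : Set D) := J.isClosed'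

instance (J : ClosedIdeal D) : IsClosed (J.toSubmodule : Set D) := J.isClosed'

theorem mul_mem_left (J : ClosedIdeal D) (a : D) {x : D} (hx : x ∈ J.toSubmodule) :
    a * x ∈ J.toSubmodule := J.mul_mem_left' a hx

theorem mul_mem_right (J : ClosedIdeal D) {x : D} (a : D) (hx : x ∈ J.toSubmodule) :
    x * a ∈ J.toSubmodule := J.mul_mem_right' a hx

theorem elemental_subset (J : ClosedIdeal D) {y : D} (hy : y ∈ J.toSubmodule)
    (hsa : star y = y) {z : D} (hz : z ∈ NonUnitalStarAlgebra.elemental ℂ y) :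
    z ∈ J.toSubmodule := by
  have h1 : ∀ a ∈ NonUnitalStarAlgebra.adjoin ℂ ({y} : Set D),
      a ∈ J.toSubmodule ∧ star a ∈ J.toSubmodule := by
    intro a ha
    induction ha using NonUnitalStarAlgebra.adjoin_induction with
    | mem x hx => rw [Set.mem_singleton_iff.mp hx, hsa]; exact ⟨hy, hy⟩
    | add x z _ _ hx hz => rw [star_add]; exact ⟨add_mem hx.1 hz.1, add_mem hx.2 hz.2⟩
    | zero => simp
    | mul x z _ _ hx hz =>
      rw [star_mul]; exact ⟨J.mul_mem_left _ hz.1, J.mul_mem_left _ hx.2⟩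
    | smul r x _ hx =>
      rw [star_smul]; exact ⟨Submodule.smul_mem _ _ hx.1, Submodule.smul_mem _ _ hx.2⟩
    | star x _ hx => rw [star_star]; exact ⟨hx.2, hx.1⟩
  exact closure_minimal (fun a ha => (h1 a ha).1) J.isClosed hz

/-- Closed two-sided ideals of C⋆-algebras are self-adjoint. -/
theorem star_mem (J : ClosedIdeal D) {x : D} (hx : x ∈ J.toSubmodule) :
    star x ∈ J.toSubmodule := by
  set y : D := x * star x with hy
  have hyJ : y ∈ J.toSubmodule := J.mul_mem_right _ hx
  have hsa : star y = y := by simp [hy]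
  let E := NonUnitalStarAlgebra.elemental ℂ y
  let _ : NonUnitalCStarAlgebra E := inferInstance
  let _ : PartialOrder E := CStarAlgebra.spectralOrder E
  let _ : StarOrderedRing E := CStarAlgebra.spectralOrderedRing E
  have hl := CStarAlgebra.increasingApproximateUnit E
  let yE : E := ⟨y, NonUnitalStarAlgebra.elemental.self_mem ℂ y⟩
  have ht : Tendsto (fun e : E => star x * (e : D)) (CStarAlgebra.approximateUnit E)
      (𝓝 (star x)) := by
    have h1 : Tendsto (fun e : E => 2 * ‖yE * e - yE‖) (CStarAlgebra.approximateUnit E) (𝓝 0) := by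
      have := (((hl.tendsto_mul_left yE).sub_const yE).norm).const_mul 2
      simpa using this
    have h2 : Tendsto (fun e : E => ‖star x * (e : D) - star x‖ ^ 2)
        (CStarAlgebra.approximateUnit E) (𝓝 0) := by
      refine squeeze_zero' (Eventually.of_forall fun _ => by positivity) ?_ h1
      filter_upwards [hl.eventually_star_eq, hl.eventually_norm] with e he hn
      have he' : star (e : D) = e := congrArg Subtype.val he
      have hn' : ‖(e : D)‖ ≤ 1 := hn
      have hne : ‖yE * e - yE‖ = ‖y * (e : D) - y‖ := rfl
      rw [hne, sq, ← CStarRing.norm_star_mul_self]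
      have : star (star x * (e : D) - star x) * (star x * (e : D) - star x)
          = (e : D) * (y * e - y) - (y * e - y) := by
        simp only [star_sub, star_mul, star_star, he', hy]
        noncomm_ring
      rw [this]
      calc _ ≤ ‖(e : D)‖ * ‖y * (e : D) - y‖ + ‖y * (e : D) - y‖ :=
            (norm_sub_le _ _).trans (by gcongr; exact norm_mul_le _ _)
        _ ≤ 1 * ‖y * (e : D) - y‖ + ‖y * (e : D) - y‖ := by gcongr
        _ = _ := by ring
    have h3 := h2.sqrt
    simp only [Real.sqrt_sq (norm_nonneg _), Real.sqrt_zero] at h3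
    exact tendsto_iff_norm_sub_tendsto_zero.mpr h3
  exact J.isClosed.mem_of_tendsto ht
    (Eventually.of_forall fun e => J.mul_mem_left _ (J.elemental_subset hyJ hsa e.2))

end Basic

/-- The quotient C⋆-algebra `D / J`, with the quotient norm. -/
def Quotient {D : Type u} [NonUnitalCStarAlgebra D] (J : ClosedIdeal D) : Type u :=
  D ⧸ J.toSubmodule

section Quot

variable {D : Type u} [NonUnitalCStarAlgebra D] (J : ClosedIdeal D)

noncomputable instance : NormedAddCommGroup J.Quotient :=
  inferInstanceAs (NormedAddCommGroup (D ⧸ J.toSubmodule))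

noncomputable instance : NormedSpace ℂ J.Quotient :=
  inferInstanceAs (NormedSpace ℂ (D ⧸ J.toSubmodule))

instance : CompleteSpace J.Quotient :=
  inferInstanceAs (CompleteSpace (D ⧸ J.toSubmodule))

/-- The underlying linear map of the quotient map. -/
def mkL : D →ₗ[ℂ] J.Quotient := J.toSubmodule.mkQ

theorem mkL_surjective : Function.Surjective J.mkL := J.toSubmodule.mkQ_surjective

theorem mkL_eq_iff {a b : D} : J.mkL a = J.mkL b ↔ a - b ∈ J.toSubmodule :=
  Submodule.Quotient.eq J.toSubmodule

theorem norm_mkL_le (a : D) : ‖J.mkL a‖ ≤ ‖a‖ := Submodule.Quotient.norm_mk_le J.toSubmodule a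

theorem exists_norm_lt (x : J.Quotient) {ε : ℝ} (hε : 0 < ε) :
    ∃ a : D, J.mkL a = x ∧ ‖a‖ < ‖x‖ + ε :=
  Submodule.Quotient.norm_mk_lt (S := J.toSubmodule) x hε

instance : Mul J.Quotient where
  mul := Quotient.map₂ (· * ·) (by
    intro a₁ a₂ ha b₁ b₂ hb
    have ha' := (Submodule.quotientRel_def J.toSubmodule).mp ha
    have hb' := (Submodule.quotientRel_def J.toSubmodule).mp hb
    refine (Submodule.quotientRel_def J.toSubmodule).mpr ?_
    have : a₁ * b₁ - a₂ * b₂ = a₁ * (b₁ - b₂) + (a₁ - a₂) * b₂ := by noncomm_ring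
    rw [this]
    exact add_mem (J.mul_mem_left _ hb') (J.mul_mem_right _ ha'))

instance : Star J.Quotient where
  star := Quotient.map star (by
    intro a b h
    have h' := (Submodule.quotientRel_def J.toSubmodule).mp h
    refine (Submodule.quotientRel_def J.toSubmodule).mpr ?_
    rw [← star_sub]
    exact J.star_mem h')

theorem mkL_mul (a b : D) : J.mkL (a * b) = J.mkL a * J.mkL b := rfl

theorem mkL_star (a : D) : J.mkL (star a) = star (J.mkL a) := rfl

/-- The C⋆-inequality for the quotient norm, proved with an approximate unit of the ideal. -/
theorem norm_mkL_sq_le (x : D) : ‖J.mkL x‖ * ‖J.mkL x‖ ≤ ‖J.mkL (star x * x)‖ := by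
  let S : NonUnitalStarSubalgebra ℂ D :=
    { carrier := J.toSubmodule
      add_mem' := fun ha hb => add_mem ha hb
      zero_mem' := zero_mem _
      mul_mem' := fun _ hb => J.mul_mem_left _ hb
      smul_mem' := fun c _ hx => Submodule.smul_mem _ c hx
      star_mem' := fun hx => J.star_mem hx }
  have : IsClosed (S : Set D) := J.isClosed
  let _ : NonUnitalCStarAlgebra S := inferInstance
  let _ : PartialOrder S := CStarAlgebra.spectralOrder S
  let _ : StarOrderedRing S := CStarAlgebra.spectralOrderedRing S
  let _ : PartialOrder (Unitization ℂ D) := CStarAlgebra.spectralOrder _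
  let _ : StarOrderedRing (Unitization ℂ D) := CStarAlgebra.spectralOrderedRing _
  have hl := CStarAlgebra.increasingApproximateUnit S
  refine le_of_forall_pos_le_add fun ε hε => ?_
  obtain ⟨b, hb, hbn⟩ := J.exists_norm_lt (J.mkL (star x * x)) (half_pos hε)
  have hjJ : b - star x * x ∈ J.toSubmodule := J.mkL_eq_iff.mp hb
  let j : S := ⟨b - star x * x, hjJ⟩
  have ht : Tendsto (fun e : S => 2 * ‖j - j * e‖) (CStarAlgebra.approximateUnit S) (𝓝 0) := by
    have := (((hl.tendsto_mul_left j).const_sub j).norm).const_mul 2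
    simpa using this
  obtain ⟨e, he, hn, h0, hs⟩ := ((ht.eventually (gt_mem_nhds (half_pos hε))).and
    (hl.eventually_norm.and (hl.eventually_nonneg.and hl.eventually_star_eq))).exists
  have hs' : star (e : D) = e := congrArg Subtype.val hs
  have he0 : (0 : Unitization ℂ D) ≤ ((e : D) : Unitization ℂ D) := by
    obtain ⟨c, hc⟩ := CStarAlgebra.nonneg_iff_eq_star_mul_self.mp h0
    have : ((e : D) : Unitization ℂ D)
        = star ((c : D) : Unitization ℂ D) * ((c : D) : Unitization ℂ D) := by
      rw [hc]; simp
    rw [this]; exact star_mul_self_nonneg _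
  have hen : ‖((e : D) : Unitization ℂ D)‖ ≤ 1 := by rw [Unitization.norm_inr]; exact hn
  have h1e : ‖(1 : Unitization ℂ D) - ((e : D) : Unitization ℂ D)‖ ≤ 1 := by
    have h := CStarAlgebra.mem_Icc_iff_norm_le_one.mpr ⟨he0, hen⟩
    exact (CStarAlgebra.mem_Icc_iff_norm_le_one.mp (Set.sub_mem_Icc_zero_iff_right.mpr h)).2
  have hmul : ∀ a : D, ‖a - a * (e : D)‖ ≤ ‖a‖ := fun a => by
    rw [← Unitization.norm_inr (𝕜 := ℂ) (a := a - a * (e : D)), ← Unitization.norm_inr (𝕜 := ℂ) (a := a)]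
    have : ((a - a * (e : D) : D) : Unitization ℂ D)
        = (a : Unitization ℂ D) * (1 - ((e : D) : Unitization ℂ D)) := by simp [mul_sub]
    rw [this]
    exact (norm_mul_le _ _).trans (mul_le_of_le_one_right (norm_nonneg _) h1e)
  have hmul' : ∀ a : D, ‖a - (e : D) * a‖ ≤ ‖a‖ := fun a => by
    have := hmul (star a)
    rw [← norm_star (a - (e : D) * a), star_sub, star_mul, hs']
    simpa using this
  have hx : J.mkL x = J.mkL (x - x * e) := by
    rw [J.mkL_eq_iff]; simpa using J.mul_mem_left x e.2
  have hje : 2 * ‖(b - star x * x) - (b - star x * x) * (e : D)‖ < ε / 2 := he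
  have key : star (x - x * (e : D)) * (x - x * (e : D))
      = ((b - b * e) - e * (b - b * e))
        - (((b - star x * x) - (b - star x * x) * e)
          - e * ((b - star x * x) - (b - star x * x) * e)) := by
    simp only [star_sub, star_mul, hs']
    noncomm_ring
  calc ‖J.mkL x‖ * ‖J.mkL x‖ ≤ ‖x - x * (e : D)‖ * ‖x - x * (e : D)‖ := by
        rw [hx]; gcongr <;> exact J.norm_mkL_le _
    _ = ‖star (x - x * (e : D)) * (x - x * (e : D))‖ := CStarRing.norm_star_mul_self.symm
    _ ≤ ‖b‖ + ‖(b - star x * x) - (b - star x * x) * (e : D)‖ := by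
        rw [key]
        refine (norm_sub_le _ _).trans (add_le_add ?_ ?_)
        · exact (hmul' _).trans (hmul _)
        · exact hmul' _
    _ ≤ ‖J.mkL (star x * x)‖ + ε := by
        have := norm_nonneg ((b - star x * x) - (b - star x * x) * (e : D))
        linarith

noncomputable instance : NonUnitalNormedRing J.Quotient :=
  { (inferInstance : NormedAddCommGroup J.Quotient) with
    mul := (· * ·)
    left_distrib := fun a b c => by
      obtain ⟨a, rfl⟩ := J.mkL_surjective a
      obtain ⟨b, rfl⟩ := J.mkL_surjective b
      obtain ⟨c, rfl⟩ := J.mkL_surjective c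
      rw [← map_add, ← mkL_mul, ← mkL_mul, ← mkL_mul, ← map_add, mul_add]
    right_distrib := fun a b c => by
      obtain ⟨a, rfl⟩ := J.mkL_surjective a
      obtain ⟨b, rfl⟩ := J.mkL_surjective b
      obtain ⟨c, rfl⟩ := J.mkL_surjective c
      rw [← map_add, ← mkL_mul, ← mkL_mul, ← mkL_mul, ← map_add, add_mul]
    zero_mul := fun a => by
      obtain ⟨a, rfl⟩ := J.mkL_surjective a
      rw [← map_zero J.mkL, ← mkL_mul, zero_mul]
    mul_zero := fun a => by
      obtain ⟨a, rfl⟩ := J.mkL_surjective a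
      rw [← map_zero J.mkL, ← mkL_mul, mul_zero]
    mul_assoc := fun a b c => by
      obtain ⟨a, rfl⟩ := J.mkL_surjective a
      obtain ⟨b, rfl⟩ := J.mkL_surjective b
      obtain ⟨c, rfl⟩ := J.mkL_surjective c
      simp only [← mkL_mul, mul_assoc]
    norm_mul_le := fun x y => by
      refine le_of_forall_gt_imp_ge_of_dense fun c hc => ?_
      have hcont : Tendsto (fun ε : ℝ => (‖x‖ + ε) * (‖y‖ + ε)) (𝓝[>] 0) (𝓝 (‖x‖ * ‖y‖)) := by
        have : Continuous fun ε : ℝ => (‖x‖ + ε) * (‖y‖ + ε) := by fun_prop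
        simpa using (this.tendsto 0).mono_left nhdsWithin_le_nhds
      obtain ⟨ε, hεc, hε⟩ := ((hcont.eventually (gt_mem_nhds hc)).and self_mem_nhdsWithin).exists
      obtain ⟨a, rfl, ha⟩ := J.exists_norm_lt x hε
      obtain ⟨b, rfl, hb⟩ := J.exists_norm_lt y hε
      rw [← mkL_mul]
      refine (J.norm_mkL_le _).trans ((norm_mul_le a b).trans (le_trans ?_ hεc.le))
      gcongr }

noncomputable instance : StarRing J.Quotient where
  star_involutive := fun a => by
    obtain ⟨a, rfl⟩ := J.mkL_surjective a
    rw [← mkL_star, ← mkL_star, star_star]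
  star_mul := fun a b => by
    obtain ⟨a, rfl⟩ := J.mkL_surjective a
    obtain ⟨b, rfl⟩ := J.mkL_surjective b
    rw [← mkL_mul, ← mkL_star, star_mul, mkL_mul, mkL_star, mkL_star]
  star_add := fun a b => by
    obtain ⟨a, rfl⟩ := J.mkL_surjective a
    obtain ⟨b, rfl⟩ := J.mkL_surjective b
    rw [← map_add, ← mkL_star, star_add, map_add, mkL_star, mkL_star]

noncomputable instance : NonUnitalCStarAlgebra J.Quotient where
  norm_mul_self_le := fun x => by
    obtain ⟨x, rfl⟩ := J.mkL_surjective x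
    rw [← mkL_star, ← mkL_mul]
    exact J.norm_mkL_sq_le x
  norm_smul_le := norm_smul_le
  smul_assoc := fun r a b => by
    obtain ⟨a, rfl⟩ := J.mkL_surjective a
    obtain ⟨b, rfl⟩ := J.mkL_surjective b
    rw [smul_eq_mul, smul_eq_mul, ← map_smul, ← mkL_mul, ← mkL_mul, smul_mul_assoc, map_smul]
  smul_comm := fun r a b => by
    obtain ⟨a, rfl⟩ := J.mkL_surjective a
    obtain ⟨b, rfl⟩ := J.mkL_surjective b
    rw [smul_eq_mul, smul_eq_mul, ← map_smul, ← mkL_mul, ← mkL_mul, mul_smul_comm, map_smul]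
  star_smul := fun r a => by
    obtain ⟨a, rfl⟩ := J.mkL_surjective a
    rw [← map_smul, ← mkL_star, ← mkL_star, star_smul, map_smul]

/-- The quotient map `D → D / J`. -/
noncomputable def proj : D →⋆ₙₐ[ℂ] J.Quotient where
  toFun := J.mkL
  map_smul' := map_smul J.mkL
  map_zero' := map_zero J.mkL
  map_add' := map_add J.mkL
  map_mul' := J.mkL_mul
  map_star' := J.mkL_star

theorem proj_surjective : Function.Surjective J.proj := J.mkL_surjective

theorem proj_eq_iff {a b : D} : J.proj a = J.proj b ↔ a - b ∈ J.toSubmodule := J.mkL_eq_iff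

variable {J} in
/-- The canonical map `D / J → D / K` for closed ideals `J ⊆ K`. -/
noncomputable def factor {K : ClosedIdeal D} (h : J.toSubmodule ≤ K.toSubmodule) :
    J.Quotient →⋆ₙₐ[ℂ] K.Quotient :=
  let f : J.Quotient →ₗ[ℂ] K.Quotient := Submodule.factor h
  have hf : ∀ a, f (J.mkL a) = K.mkL a := fun _ => rfl
  { toFun := f
    map_smul' := map_smul f
    map_zero' := map_zero f
    map_add' := map_add f
    map_mul' := fun a b => by
      obtain ⟨a, rfl⟩ := J.mkL_surjective a
      obtain ⟨b, rfl⟩ := J.mkL_surjective b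
      rw [← mkL_mul, hf, hf, hf, mkL_mul]
    map_star' := fun a => by
      obtain ⟨a, rfl⟩ := J.mkL_surjective a
      rw [← mkL_star, hf, hf, mkL_star] }

theorem factor_proj {K : ClosedIdeal D} (h : J.toSubmodule ≤ K.toSubmodule) (a : D) :
    factor h (J.proj a) = K.proj a := rfl

end Quot
end ClosedIdeal

namespace ClosedIdeal

theorem le_of_closure {D : Type u} [NonUnitalCStarAlgebra D] {J : ℕ → ClosedIdeal D}
    {K : ClosedIdeal D}
    (hK : (K.toSubmodule : Set D) = closure (⋃ n, ((J n).toSubmodule : Set D))) (n : ℕ) :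
    (J n).toSubmodule ≤ K.toSubmodule := fun x hx => by
  have : x ∈ (K.toSubmodule : Set D) := by
    rw [hK]; exact subset_closure (Set.mem_iUnion.mpr ⟨n, hx⟩)
  exact this

end ClosedIdeal

/-- Semiprojectivity of a (separable) C⋆-algebra `A`: for every increasing sequence `J n` of closed
ideals of a C⋆-algebra `D`, with `K` the closure of their union, every ⋆-homomorphism `A → D / K`
lifts to a ⋆-homomorphism `A → D / J n` for some `n`. -/
def IsSemiprojective (A : Type u) [NonUnitalCStarAlgebra A] : Prop :=
  ∀ (D : Type u) [NonUnitalCStarAlgebra D] (J : ℕ → ClosedIdeal D) (K : ClosedIdeal D)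
    (_ : ∀ m n, m ≤ n → (J m).toSubmodule ≤ (J n).toSubmodule)
    (hK : (K.toSubmodule : Set D) = closure (⋃ n, ((J n).toSubmodule : Set D)))
    (φ : A →⋆ₙₐ[ℂ] K.Quotient),
    ∃ (n : ℕ) (ψ : A →⋆ₙₐ[ℂ] (J n).Quotient),
      ∀ a, ClosedIdeal.factor (ClosedIdeal.le_of_closure hK n) (ψ a) = φ a


section Transfer

/-- Transport of a C⋆-algebra structure along a bijection. -/
@[reducible] noncomputable def Equiv.nonUnitalCStarAlgebra {X : Type u} {Y : Type v} (e : X ≃ Y)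
    [NonUnitalCStarAlgebra Y] : NonUnitalCStarAlgebra X :=
  let _ : NonUnitalRing X := e.nonUnitalRing
  let _ : NonUnitalNormedRing X :=
    NonUnitalNormedRing.induced X Y (e.ringEquiv : X →ₙ+* Y) e.injective
  let _ : StarRing X := e.starRing
  let _ : Module ℂ X := e.module ℂ
  have hadd : ∀ a b, e (a + b) = e a + e b := fun a b => e.apply_symm_apply _
  have hmul : ∀ a b, e (a * b) = e a * e b := fun a b => e.apply_symm_apply _
  have hsmul : ∀ (r : ℂ) a, e (r • a) = r • e a := fun r a => e.apply_symm_apply _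
  have hstar : ∀ a, e (star a) = star (e a) := fun a => e.apply_symm_apply _
  have hnorm : ∀ a : X, ‖a‖ = ‖e a‖ := fun a => rfl
  have hdist : Isometry e := Isometry.of_dist_eq fun a b => rfl
  { complete := by
      have : CompleteSpace X := by
        rw [completeSpace_congr (e := e) hdist.isUniformEmbedding]; infer_instance
      intro f hf; exact this.complete hf
    norm_mul_self_le := fun x => by
      rw [hnorm, hnorm, hmul, hstar]; exact CStarRing.norm_mul_self_le _
    norm_smul_le := fun r x => by rw [hnorm, hsmul, hnorm]; exact norm_smul_le _ _
    smul_assoc := fun r a b => e.injective (by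
      simp only [smul_eq_mul, hmul, hsmul, smul_mul_assoc])
    smul_comm := fun r a b => e.injective (by
      simp only [smul_eq_mul, hmul, hsmul, mul_smul_comm])
    star_smul := fun r a => e.injective (by simp only [hstar, hsmul, star_smul]) }

end Transfer

/-- A representation: ⋆-homomorphisms from the C⋆-algebras `B i` into one C⋆-algebra `D` that
satisfy the relations `R`. -/
structure CStarRep {ι : Type} (B : ι → Type u) [∀ i, NonUnitalCStarAlgebra (B i)]
    (R : ∀ (D : Type u) [NonUnitalCStarAlgebra D], (∀ i, B i →⋆ₙₐ[ℂ] D) → Prop) where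
  D : Type u
  [inst : NonUnitalCStarAlgebra D]
  hom : ∀ i, B i →⋆ₙₐ[ℂ] D
  rel : R D hom

attribute [instance] CStarRep.inst

namespace UnivCStar

variable {ι : Type} (B : ι → Type u) [∀ i, NonUnitalCStarAlgebra (B i)]
    (R : ∀ (D : Type u) [NonUnitalCStarAlgebra D], (∀ i, B i →⋆ₙₐ[ℂ] D) → Prop)

/-- The bounded product of the targets of all families satisfying `R`. -/
abbrev Big := lp (fun r : CStarRep B R => r.D) ∞

/-- The copy of `B i` inside the product. -/
noncomputable def bigGen (i : ι) : B i →⋆ₙₐ[ℂ] Big B R where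
  toFun b := ⟨fun r => r.hom i b, memℓp_infty ⟨‖b‖, by
    rintro _ ⟨r, rfl⟩; exact NonUnitalStarAlgHom.norm_apply_le _ _⟩⟩
  map_smul' _ _ := by ext r; simp
  map_zero' := by ext r; simp
  map_add' _ _ := by ext r; exact map_add _ _ _
  map_mul' _ _ := by ext r; simp
  map_star' _ := by ext r; exact map_star _ _

def gens : Set (Big B R) := ⋃ i, Set.range (bigGen B R i)

/-- The C⋆-subalgebra generated by all the copies. -/
noncomputable def bigAlg : NonUnitalStarSubalgebra ℂ (Big B R) :=
  (NonUnitalStarAlgebra.adjoin ℂ (gens B R)).topologicalClosure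

instance : IsClosed (bigAlg B R : Set (Big B R)) :=
  NonUnitalStarSubalgebra.isClosed_topologicalClosure _

instance small_bigAlg : Small.{u} (bigAlg B R) := by
  let X := Σ i, B i
  let f : X → Big B R := fun x => bigGen B R x.1 x.2
  let F : FreeNonUnitalNonAssocAlgebra ℂ X →ₙₐ[ℂ] Big B R :=
    FreeNonUnitalNonAssocAlgebra.lift ℂ f
  have hf : ∀ x, F (FreeNonUnitalNonAssocAlgebra.of ℂ x) = f x := fun x =>
    FreeNonUnitalNonAssocAlgebra.lift_of_apply ℂ f x
  have h1 : ∀ a ∈ NonUnitalStarAlgebra.adjoin ℂ (gens B R), a ∈ Set.range F := by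
    intro a ha
    replace ha : a ∈ NonUnitalAlgebra.adjoin ℂ (gens B R ∪ star (gens B R)) := ha
    induction ha using NonUnitalAlgebra.adjoin_induction with
    | mem x hx =>
      rcases hx with hx | hx
      · obtain ⟨i, b, rfl⟩ := Set.mem_iUnion.mp hx
        exact ⟨_, hf ⟨i, b⟩⟩
      · obtain ⟨i, b, hb⟩ := Set.mem_iUnion.mp (Set.mem_star.mp hx)
        exact ⟨_, (hf ⟨i, star b⟩).trans (by
          change bigGen B R i (star b) = x
          rw [map_star, hb, star_star])⟩
    | add x y _ _ hx hy =>
      obtain ⟨x', rfl⟩ := hx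
      obtain ⟨y', rfl⟩ := hy
      exact ⟨x' + y', map_add F _ _⟩
    | zero => exact ⟨0, map_zero F⟩
    | mul x y _ _ hx hy =>
      obtain ⟨x', rfl⟩ := hx
      obtain ⟨y', rfl⟩ := hy
      exact ⟨x' * y', map_mul F _ _⟩
    | smul r x _ hx =>
      obtain ⟨x', rfl⟩ := hx
      exact ⟨r • x', map_smul F _ _⟩
  have h2 : (bigAlg B R : Set (Big B R)) ⊆
      Set.range fun s : ℕ → FreeNonUnitalNonAssocAlgebra ℂ X => limUnder atTop fun n => F (s n) := by
    intro a ha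
    obtain ⟨s, hs, hlim⟩ := mem_closure_iff_seq_limit.mp ha
    choose t ht using fun n => h1 (s n) (hs n)
    exact ⟨t, by simp only [ht]; exact hlim.limUnder_eq⟩
  exact small_subset h2

end UnivCStar

/-- The universal C⋆-algebra generated by copies of the C⋆-algebras `B i` subject to the relations
`R`: the C⋆-algebra generated by the canonical copies of the `B i` in the bounded product of all
representations, moved to `Type u` along a bijection. See `gen`, `lift`, `lift_gen`, `hom_ext`. -/
def UnivCStar {ι : Type} (B : ι → Type u) [∀ i, NonUnitalCStarAlgebra (B i)]
    (R : ∀ (D : Type u) [NonUnitalCStarAlgebra D], (∀ i, B i →⋆ₙₐ[ℂ] D) → Prop) : Type u :=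
  Shrink.{u} (UnivCStar.bigAlg B R)

namespace UnivCStar

variable {ι : Type} {B : ι → Type u} [∀ i, NonUnitalCStarAlgebra (B i)]
    {R : ∀ (D : Type u) [NonUnitalCStarAlgebra D], (∀ i, B i →⋆ₙₐ[ℂ] D) → Prop}

variable (B R) in
noncomputable def toBig : UnivCStar B R ≃ bigAlg B R := (equivShrink _).symm

noncomputable instance : NonUnitalCStarAlgebra (UnivCStar B R) :=
  (toBig B R).nonUnitalCStarAlgebra

variable (B R) in
noncomputable def toBigHom : UnivCStar B R ≃⋆ₐ[ℂ] bigAlg B R where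
  toEquiv := toBig B R
  map_mul' _ _ := (toBig B R).apply_symm_apply _
  map_add' _ _ := (toBig B R).apply_symm_apply _
  map_star' _ := (toBig B R).apply_symm_apply _
  map_smul' _ _ := (toBig B R).apply_symm_apply _


theorem gen_mem (i : ι) (b : B i) : bigGen B R i b ∈ bigAlg B R :=
  NonUnitalStarSubalgebra.le_topologicalClosure _
    (NonUnitalStarAlgebra.subset_adjoin ℂ _ (Set.mem_iUnion.mpr ⟨i, b, rfl⟩))

variable (B R) in
/-- The canonical copy of `B i` in the universal C⋆-algebra. -/
noncomputable def gen (i : ι) : B i →⋆ₙₐ[ℂ] UnivCStar B R :=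
  ((toBigHom B R).symm : bigAlg B R →⋆ₙₐ[ℂ] UnivCStar B R).comp
    (NonUnitalStarAlgHom.codRestrict (bigGen B R i) (bigAlg B R) fun b => gen_mem i b)

theorem toBigHom_gen (i : ι) (b : B i) (r : CStarRep B R) :
    ((toBigHom B R (UnivCStar.gen B R i b) : bigAlg B R) : Big B R) r = r.hom i b := by
  have : toBigHom B R (UnivCStar.gen B R i b) = ⟨bigGen B R i b, gen_mem i b⟩ :=
    (toBigHom B R).apply_symm_apply _
  rw [this]; rfl

/-- The ⋆-homomorphism out of the universal C⋆-algebra determined by a family satisfying `R`. -/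
noncomputable def lift {D : Type u} [NonUnitalCStarAlgebra D] (f : ∀ i, B i →⋆ₙₐ[ℂ] D)
    (hf : R D f) : UnivCStar B R →⋆ₙₐ[ℂ] D where
  toFun x := ((toBigHom B R x : bigAlg B R) : Big B R) ⟨D, f, hf⟩
  map_smul' c x := by rw [map_smul]; rfl
  map_zero' := by rw [map_zero]; rfl
  map_add' x y := by rw [map_add]; rfl
  map_mul' x y := by rw [map_mul]; rfl
  map_star' x := by rw [map_star]; rfl

theorem lift_gen {D : Type u} [NonUnitalCStarAlgebra D] (f : ∀ i, B i →⋆ₙₐ[ℂ] D) (hf : R D f)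
    (i : ι) (b : B i) : lift f hf (UnivCStar.gen B R i b) = f i b :=
  toBigHom_gen i b ⟨D, f, hf⟩

theorem ext_apply {x y : UnivCStar B R}
    (h : ∀ r : CStarRep B R, lift r.hom r.rel x = lift r.hom r.rel y) : x = y := by
  apply (toBigHom B R).injective
  ext r
  exact h r

/-- A closed property stable under the operations holds everywhere if it holds on the copies. -/
theorem induction {p : UnivCStar B R → Prop} (hgen : ∀ i b, p (UnivCStar.gen B R i b))
    (hadd : ∀ x y, p x → p y → p (x + y)) (hmul : ∀ x y, p x → p y → p (x * y))
    (hsmul : ∀ (c : ℂ) x, p x → p (c • x)) (hstar : ∀ x, p x → p (star x)) (hzero : p 0)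
    (hcl : IsClosed {x | p x}) (x : UnivCStar B R) : p x := by
  let g : bigAlg B R → UnivCStar B R := (toBigHom B R).symm
  have hiso : Isometry (toBig B R) := Isometry.of_dist_eq fun a b => rfl
  have hg : Isometry g := hiso.right_inv (toBig B R).right_inv
  have hadj : ∀ a (ha : a ∈ NonUnitalStarAlgebra.adjoin ℂ (gens B R)),
      p (g ⟨a, NonUnitalStarSubalgebra.le_topologicalClosure _ ha⟩) := by
    intro a ha
    induction ha using NonUnitalStarAlgebra.adjoin_induction with
    | mem x hx =>
      obtain ⟨i, b, rfl⟩ := Set.mem_iUnion.mp hx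
      exact hgen i b
    | add x y hx hy h1 h2 =>
      have := hadd _ _ h1 h2
      rw [← map_add (toBigHom B R).symm] at this
      exact this
    | zero =>
      have := hzero
      rw [← map_zero (toBigHom B R).symm] at this
      exact this
    | mul x y hx hy h1 h2 =>
      have := hmul _ _ h1 h2
      rw [← map_mul (toBigHom B R).symm] at this
      exact this
    | smul r x hx h =>
      have := hsmul r _ h
      rw [← map_smul (toBigHom B R).symm] at this
      exact this
    | star x hx h =>
      have := hstar _ h
      rw [← map_star (toBigHom B R).symm] at this
      exact this
  have hall : ∀ z : bigAlg B R, p (g z) := by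
    rintro ⟨z, hz⟩
    obtain ⟨s, hs, hlim⟩ := mem_closure_iff_seq_limit.mp hz
    let t : ℕ → bigAlg B R :=
      fun n => ⟨s n, NonUnitalStarSubalgebra.le_topologicalClosure _ (hs n)⟩
    have ht : Tendsto t atTop (𝓝 ⟨z, hz⟩) := tendsto_subtype_rng.mpr hlim
    exact hcl.mem_of_tendsto ((hg.continuous.tendsto _).comp ht)
      (Eventually.of_forall fun n => hadj _ (hs n))
  have := hall (toBigHom B R x)
  rwa [show g (toBigHom B R x) = x from (toBigHom B R).symm_apply_apply x] at this

/-- A ⋆-homomorphism out of the universal C⋆-algebra is determined by the canonical copies. -/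
theorem hom_ext {D : Type v} [NonUnitalCStarAlgebra D] {f g : UnivCStar B R →⋆ₙₐ[ℂ] D}
    (h : ∀ i b, f (UnivCStar.gen B R i b) = g (UnivCStar.gen B R i b)) : f = g := by
  ext x
  induction x using UnivCStar.induction with
  | hgen i b => exact h i b
  | hadd x y hx hy => rw [map_add, map_add, hx, hy]
  | hmul x y hx hy => rw [map_mul, map_mul, hx, hy]
  | hsmul c x hx => rw [map_smul, map_smul, hx]
  | hstar x hx => rw [map_star, map_star, hx]
  | hzero => rw [map_zero, map_zero]
  | hcl => 
    exact isClosed_eq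
      (AddMonoidHomClass.continuous_of_bound f 1 fun x => by
        simpa using NonUnitalStarAlgHom.norm_apply_le f x)
      (AddMonoidHomClass.continuous_of_bound g 1 fun x => by
        simpa using NonUnitalStarAlgHom.norm_apply_le g x)

end UnivCStar

/-- The full free product of the C⋆-algebras `B i` (non-unital: units are not identified). -/
abbrev FullFreeProduct {ι : Type} (B : ι → Type u) [∀ i, NonUnitalCStarAlgebra (B i)] : Type u :=
  UnivCStar B fun _ _ _ => True

/-- The ranges of the `f i` commute pairwise, and the `f i` send the units to a common element. -/
def CommutingWithCommonUnit {ι : Type} (B : ι → Type u) [∀ i, CStarAlgebra (B i)]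
    (D : Type u) [NonUnitalCStarAlgebra D] (f : ∀ i, B i →⋆ₙₐ[ℂ] D) : Prop :=
  (∀ i j, i ≠ j → ∀ (a : B i) (b : B j), Commute (f i a) (f j b)) ∧ ∀ i j, f i 1 = f j 1

/-- The maximal tensor product of a nonempty family of unital C⋆-algebras: the universal C⋆-algebra
generated by commuting copies of the `B i` with a common unit. -/
abbrev MaxTensorProduct {ι : Type} (B : ι → Type u) [∀ i, CStarAlgebra (B i)] : Type u :=
  UnivCStar B (CommutingWithCommonUnit B)

theorem MaxTensorProduct.rel_gen {ι : Type} (B : ι → Type u) [∀ i, CStarAlgebra (B i)] :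
    CommutingWithCommonUnit B (MaxTensorProduct B)
      (UnivCStar.gen B (CommutingWithCommonUnit B)) := by
  constructor
  · intro i j hij a b
    apply UnivCStar.ext_apply
    intro r
    rw [map_mul, map_mul, UnivCStar.lift_gen, UnivCStar.lift_gen]
    exact r.rel.1 i j hij a b
  · intro i j
    apply UnivCStar.ext_apply
    intro r
    rw [UnivCStar.lift_gen, UnivCStar.lift_gen]
    exact r.rel.2 i j

theorem MaxTensorProduct.gen_one_mul {ι : Type} (B : ι → Type u) [∀ i, CStarAlgebra (B i)] (i : ι)
    (x : MaxTensorProduct B) :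
    UnivCStar.gen B (CommutingWithCommonUnit B) i 1 * x = x ∧
      x * UnivCStar.gen B (CommutingWithCommonUnit B) i 1 = x := by
  induction x using UnivCStar.induction with
  | hgen j b =>
    rw [(MaxTensorProduct.rel_gen B).2 i j, ← map_mul, ← map_mul, one_mul, mul_one]; exact ⟨rfl, rfl⟩
  | hadd x y hx hy => rw [mul_add, add_mul, hx.1, hy.1, hx.2, hy.2]; exact ⟨rfl, rfl⟩
  | hmul x y hx hy => rw [← mul_assoc, hx.1, mul_assoc, hy.2]; exact ⟨rfl, rfl⟩
  | hsmul c x hx => rw [mul_smul_comm, smul_mul_assoc, hx.1, hx.2]; exact ⟨rfl, rfl⟩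
  | hstar x hx =>
    have h : star (UnivCStar.gen B (CommutingWithCommonUnit B) i 1)
        = UnivCStar.gen B (CommutingWithCommonUnit B) i 1 := by rw [← map_star, star_one]
    constructor
    · conv_lhs => rw [← h, ← star_mul, hx.2]
    · conv_lhs => rw [← h, ← star_mul, hx.1]
  | hzero => simp
  | hcl =>
    exact (isClosed_eq (by fun_prop) (by fun_prop)).inter (isClosed_eq (by fun_prop) (by fun_prop))

/-- The canonical quotient map from the full free product onto the maximal tensor product: it sends
the copy of each `B i` to the copy of `B i` by the identity of `B i`. -/
noncomputable def freeToTensor {ι : Type} (B : ι → Type u) [∀ i, CStarAlgebra (B i)] :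
    FullFreeProduct B →⋆ₙₐ[ℂ] MaxTensorProduct B :=
  UnivCStar.lift (UnivCStar.gen B (CommutingWithCommonUnit B)) trivial

theorem freeToTensor_gen {ι : Type} (B : ι → Type u) [∀ i, CStarAlgebra (B i)] (i : ι) (b : B i) :
    freeToTensor B (UnivCStar.gen B _ i b) =
      UnivCStar.gen B (CommutingWithCommonUnit B) i b :=
  UnivCStar.lift_gen _ _ i b

/-- The family consisting of `A` and, for each `k : κ`, a copy of `P`. -/
def WithCopies (A P : Type u) (κ : Type) : Option κ → Type u
  | none => A
  | some _ => P

noncomputable instance (A P : Type u) [CStarAlgebra A] [CStarAlgebra P] (κ : Type) :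
    ∀ k, CStarAlgebra (WithCopies A P κ k)
  | none => inferInstanceAs (CStarAlgebra A)
  | some _ => inferInstanceAs (CStarAlgebra P)

/-! Since `P` is isomorphic to its infinite tensor power and `A` absorbs `P`, there is an
isomorphism `A ⊗ P^∞ ≅ A` (`absorbEquiv`). Let F be the full free product of `A` with infinitely
many copies of `P`. The tensor relations between `A` and the first k copies give an increasing
sequence of closed ideals J_k of F, and F modulo the closure of their union receives a map from `A ⊗
P^∞ ≅ A`. Semiprojectivity lifts this map to some F / J_k, so that only finitely many copies of `P`
are still subject to relations.

These remaining relations have to be realised in `A * P * ⋯ * P`, where no relation holds between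
different free factors. They are realised inside the factor `A` alone: `A ≅ A ⊗ P^k` provides k
commuting copies of `P` in `A`, which commute with a further copy of `A`. So F is mapped to the
finite free product by sending `A` and the first k copies of `P` into the factor `A`, the next n - 1
copies to the first n - 1 factors `P`, and all the others into the last factor through `P^∞ ≅ P`.
This map kills J_k (`commuteOn_spread_lt`), so it can be composed with the lift.

In the tensor product all the relations hold (`commuteOn_spread`), and there the construction
becomes a regrouping map `A ⊗ P^∞ → A ⊗ P^n`. It has a right inverse (`regroup_ungroup`, resting on
`regroup_splitOff`), and precomposing with it produces the splitting. -/

namespace ClosedIdeal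

/-! ### Closed ideals: descent to quotients, unions, common kernels -/

variable {D : Type u} [NonUnitalCStarAlgebra D]

/-- A ⋆-homomorphism vanishing on `J` descends to `D / J`. -/
noncomputable def liftQuotient (J : ClosedIdeal D) {E : Type v} [NonUnitalCStarAlgebra E]
    (f : D →⋆ₙₐ[ℂ] E) (hf : ∀ x ∈ J.toSubmodule, f x = 0) : J.Quotient →⋆ₙₐ[ℂ] E :=
  let g : J.Quotient →ₗ[ℂ] E := J.toSubmodule.liftQ (f : D →ₗ[ℂ] E) hf
  have hg : ∀ a, g (J.mkL a) = f a := fun _ => rfl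
  { toFun := g
    map_smul' := map_smul g
    map_zero' := map_zero g
    map_add' := map_add g
    map_mul' := fun a b => by
      obtain ⟨a, rfl⟩ := J.mkL_surjective a
      obtain ⟨b, rfl⟩ := J.mkL_surjective b
      rw [← mkL_mul, hg, hg, hg, map_mul]
    map_star' := fun a => by
      obtain ⟨a, rfl⟩ := J.mkL_surjective a
      rw [← mkL_star, hg, hg, map_star] }

/-- The closure of the union of an increasing sequence of closed ideals. -/
noncomputable def closureUnion (J : ℕ → ClosedIdeal D)
    (hJ : ∀ m n, m ≤ n → (J m).toSubmodule ≤ (J n).toSubmodule) : ClosedIdeal D :=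
  have hcoe : ((⨆ n, (J n).toSubmodule : Submodule ℂ D) : Set D)
      = ⋃ n, ((J n).toSubmodule : Set D) :=
    Submodule.coe_iSup_of_directed _ (directed_of_isDirected_le fun _ _ h => hJ _ _ h)
  have hmem : ∀ x, x ∈ (⨆ n, (J n).toSubmodule : Submodule ℂ D) ↔ ∃ n, x ∈ (J n).toSubmodule :=
    fun x => by rw [← SetLike.mem_coe, hcoe]; simp
  { (⨆ n, (J n).toSubmodule : Submodule ℂ D).topologicalClosure with
    mul_mem_left' := fun a x hx =>
      map_mem_closure (by fun_prop : Continuous fun y => a * y) hx fun y hy => by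
        obtain ⟨n, hn⟩ := (hmem y).mp hy
        exact (hmem _).mpr ⟨n, (J n).mul_mem_left a hn⟩
    mul_mem_right' := fun {x} a hx =>
      map_mem_closure (f := fun y => y * a) (by fun_prop) hx fun y hy => by
        obtain ⟨n, hn⟩ := (hmem y).mp hy
        exact (hmem _).mpr ⟨n, (J n).mul_mem_right a hn⟩
    isClosed' := Submodule.isClosed_topologicalClosure _ }

theorem coe_closureUnion (J : ℕ → ClosedIdeal D)
    (hJ : ∀ m n, m ≤ n → (J m).toSubmodule ≤ (J n).toSubmodule) :
    ((closureUnion J hJ).toSubmodule : Set D) = closure (⋃ n, ((J n).toSubmodule : Set D)) := by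
  rw [← Submodule.coe_iSup_of_directed (fun n => (J n).toSubmodule)
    (directed_of_isDirected_le fun _ _ h => hJ _ _ h)]
  exact Submodule.topologicalClosure_coe _

end ClosedIdeal

theorem NonUnitalStarAlgHom.continuous_of_cstar {D : Type u} {E : Type v}
    [NonUnitalCStarAlgebra D] [NonUnitalCStarAlgebra E] (f : D →⋆ₙₐ[ℂ] E) : Continuous f :=
  AddMonoidHomClass.continuous_of_bound f 1 fun x => by
    simpa using NonUnitalStarAlgHom.norm_apply_le f x

/-- The elements killed by every ⋆-homomorphism with property `R` form a closed ideal. -/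
def commonKernel (D : Type u) [NonUnitalCStarAlgebra D]
    (R : ∀ (E : Type u) [NonUnitalCStarAlgebra E], (D →⋆ₙₐ[ℂ] E) → Prop) : ClosedIdeal D where
  carrier := {x | ∀ (E : Type u) [NonUnitalCStarAlgebra E] (f : D →⋆ₙₐ[ℂ] E), R E f → f x = 0}
  add_mem' := fun hx hy E _ f hf => by rw [map_add, hx E f hf, hy E f hf, add_zero]
  zero_mem' := fun E _ f _ => map_zero f
  smul_mem' := fun c x hx E _ f hf => by rw [map_smul, hx E f hf, smul_zero]
  mul_mem_left' := fun a x hx E _ f hf => by rw [map_mul, hx E f hf, mul_zero]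
  mul_mem_right' := fun a hx E _ f hf => by rw [map_mul, hx E f hf, zero_mul]
  isClosed' := by
    simp only [Set.ofPred_forall]
    exact isClosed_iInter fun E => isClosed_iInter fun _ => isClosed_iInter fun f =>
      isClosed_iInter fun _ => isClosed_eq f.continuous_of_cstar continuous_const

/-! ### Free and tensor products of `A` with copies of `P` -/

namespace WithCopies

variable {A P : Type u} [CStarAlgebra A] [CStarAlgebra P] {κ : Type}
  {E E' : Type u} [NonUnitalCStarAlgebra E] [NonUnitalCStarAlgebra E']

/-- The family of ⋆-homomorphisms given by one on `A` and one on each copy of `P`. -/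
def homs (f : A →⋆ₙₐ[ℂ] E) (g : κ → P →⋆ₙₐ[ℂ] E) : ∀ i, WithCopies A P κ i →⋆ₙₐ[ℂ] E
  | none => f
  | some k => g k

/-- The images of `A` and of the copies of `P` indexed by `S` commute and have a common unit. -/
structure CommuteOn (S : Set κ) (f : A →⋆ₙₐ[ℂ] E) (g : κ → P →⋆ₙₐ[ℂ] E) : Prop where
  base : ∀ k ∈ S, ∀ a p, Commute (f a) (g k p)
  copies : ∀ k ∈ S, ∀ l ∈ S, k ≠ l → ∀ p q, Commute (g k p) (g l q)
  unit : ∀ k ∈ S, g k 1 = f 1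

theorem CommuteOn.comp {S : Set κ} {f : A →⋆ₙₐ[ℂ] E} {g : κ → P →⋆ₙₐ[ℂ] E}
    (h : CommuteOn S f g) (φ : E →⋆ₙₐ[ℂ] E') : CommuteOn S (φ.comp f) fun k => φ.comp (g k) where
  base k hk a p := (h.base k hk a p).map φ
  copies k hk l hl hkl p q := (h.copies k hk l hl hkl p q).map φ
  unit k hk := congrArg φ (h.unit k hk)

theorem CommuteOn.commutingWithCommonUnit {f : A →⋆ₙₐ[ℂ] E} {g : κ → P →⋆ₙₐ[ℂ] E}
    (h : CommuteOn Set.univ f g) : CommutingWithCommonUnit (WithCopies A P κ) E (homs f g) := by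
  constructor
  · rintro (_ | k) (_ | l) hkl a b
    · exact absurd rfl hkl
    · exact h.base l trivial a b
    · exact (h.base k trivial b a).symm
    · exact h.copies k trivial l trivial (fun e => hkl (congrArg some e)) a b
  · have h1 : ∀ i, homs (κ := κ) f g i 1 = f 1 := by
      rintro (_ | k)
      · rfl
      · exact h.unit k trivial
    intro i j
    rw [h1, h1]

section Univ

variable (A P κ) (R : ∀ (D : Type u) [NonUnitalCStarAlgebra D],
  (∀ i, WithCopies A P κ i →⋆ₙₐ[ℂ] D) → Prop)

/-- The canonical copy of `A`. -/
noncomputable def genBase : A →⋆ₙₐ[ℂ] UnivCStar (WithCopies A P κ) R := UnivCStar.gen _ R none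

/-- The canonical copies of `P`. -/
noncomputable def genCopy (k : κ) : P →⋆ₙₐ[ℂ] UnivCStar (WithCopies A P κ) R :=
  UnivCStar.gen _ R (some k)

variable {A P κ R}

theorem hom_ext {F : Type v} [NonUnitalCStarAlgebra F]
    {φ ψ : UnivCStar (WithCopies A P κ) R →⋆ₙₐ[ℂ] F}
    (h : ∀ a, φ (genBase A P κ R a) = ψ (genBase A P κ R a))
    (h' : ∀ k p, φ (genCopy A P κ R k p) = ψ (genCopy A P κ R k p)) : φ = ψ :=
  UnivCStar.hom_ext fun i b => match i, b with
    | none, b => h b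
    | some k, b => h' k b

end Univ

variable (A P κ) in
abbrev Free : Type u := FullFreeProduct (WithCopies A P κ)

variable (A P κ) in
abbrev Tensor : Type u := MaxTensorProduct (WithCopies A P κ)

namespace Free

variable (A P) in
noncomputable def base : A →⋆ₙₐ[ℂ] Free A P κ := genBase A P κ _

variable (A P) in
noncomputable def copy (k : κ) : P →⋆ₙₐ[ℂ] Free A P κ := genCopy A P κ _ k

noncomputable def lift (f : A →⋆ₙₐ[ℂ] E) (g : κ → P →⋆ₙₐ[ℂ] E) : Free A P κ →⋆ₙₐ[ℂ] E :=
  UnivCStar.lift (homs f g) trivial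

theorem lift_base (f : A →⋆ₙₐ[ℂ] E) (g : κ → P →⋆ₙₐ[ℂ] E) (a : A) :
    lift f g (base A P a) = f a :=
  UnivCStar.lift_gen (homs f g) trivial none a

theorem lift_copy (f : A →⋆ₙₐ[ℂ] E) (g : κ → P →⋆ₙₐ[ℂ] E) (k : κ) (p : P) :
    lift f g (copy A P k p) = g k p :=
  UnivCStar.lift_gen (homs f g) trivial (some k) p

end Free

namespace Tensor

variable (A P) in
noncomputable def base : A →⋆ₙₐ[ℂ] Tensor A P κ := genBase A P κ _

variable (A P) in
noncomputable def copy (k : κ) : P →⋆ₙₐ[ℂ] Tensor A P κ := genCopy A P κ _ k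

theorem commuteOn : CommuteOn (κ := κ) Set.univ (base A P) (copy A P) where
  base k _ a p := (MaxTensorProduct.rel_gen (WithCopies A P κ)).1 none (some k) nofun a p
  copies k _ l _ hkl p q := (MaxTensorProduct.rel_gen (WithCopies A P κ)).1 (some k) (some l)
    (fun e => hkl (Option.some_injective _ e)) p q
  unit k _ := (MaxTensorProduct.rel_gen (WithCopies A P κ)).2 (some k) none

theorem base_one_mul (x : Tensor A P κ) : base A P 1 * x = x :=
  (MaxTensorProduct.gen_one_mul (WithCopies A P κ) none x).1

noncomputable def lift (f : A →⋆ₙₐ[ℂ] E) (g : κ → P →⋆ₙₐ[ℂ] E) (h : CommuteOn Set.univ f g) :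
    Tensor A P κ →⋆ₙₐ[ℂ] E :=
  UnivCStar.lift (homs f g) h.commutingWithCommonUnit

variable {f : A →⋆ₙₐ[ℂ] E} {g : κ → P →⋆ₙₐ[ℂ] E} (h : CommuteOn Set.univ f g)

theorem lift_base (a : A) : lift f g h (base A P a) = f a :=
  UnivCStar.lift_gen (homs f g) h.commutingWithCommonUnit none a

theorem lift_copy (k : κ) (p : P) : lift f g h (copy A P k p) = g k p :=
  UnivCStar.lift_gen (homs f g) h.commutingWithCommonUnit (some k) p

theorem hom_ext {φ ψ : Tensor A P κ →⋆ₙₐ[ℂ] E} (h : ∀ a, φ (base A P a) = ψ (base A P a))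
    (h' : ∀ k p, φ (copy A P k p) = ψ (copy A P k p)) : φ = ψ :=
  WithCopies.hom_ext h h'

end Tensor

theorem freeToTensor_base (a : A) :
    freeToTensor (WithCopies A P κ) (Free.base A P a) = Tensor.base A P a :=
  freeToTensor_gen (WithCopies A P κ) none a

theorem freeToTensor_copy (k : κ) (p : P) :
    freeToTensor (WithCopies A P κ) (Free.copy A P k p) = Tensor.copy A P k p :=
  freeToTensor_gen (WithCopies A P κ) (some k) p

end WithCopies

/-! ### Infinite tensor powers, units and commutants -/

/-- The infinite maximal tensor power. -/
abbrev InfTensorPower (P : Type u) [CStarAlgebra P] : Type u := MaxTensorProduct fun _ : ℕ => P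

namespace InfTensorPower

variable {P : Type u} [CStarAlgebra P] {E : Type u} [NonUnitalCStarAlgebra E]

variable (P) in
noncomputable def copy (k : ℕ) : P →⋆ₙₐ[ℂ] InfTensorPower P := UnivCStar.gen (fun _ : ℕ => P) _ k

theorem commute {k l : ℕ} (h : k ≠ l) (p q : P) : Commute (copy P k p) (copy P l q) :=
  (MaxTensorProduct.rel_gen fun _ : ℕ => P).1 k l h p q

/-- The tensor power carries only a non-unital structure, so preservation of the unit is derived:
the common unit of the copies acts as an identity on the preimage of `1`, hence its image acts as an
identity on `1`. -/
theorem map_copy_one (s : InfTensorPower P ≃⋆ₐ[ℂ] P) (k : ℕ) : s (copy P k 1) = 1 := by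
  have h := (MaxTensorProduct.gen_one_mul (fun _ : ℕ => P) k (s.symm 1)).1
  have h2 := congrArg s h
  rw [map_mul, StarAlgEquiv.apply_symm_apply, mul_one] at h2
  exact h2

end InfTensorPower

/-- An element commuting with the images of the canonical copies commutes with the whole image. -/
theorem UnivCStar.commute_of_commute_gen {ι : Type} {B : ι → Type u}
    [∀ i, NonUnitalCStarAlgebra (B i)]
    {R : ∀ (D : Type u) [NonUnitalCStarAlgebra D], (∀ i, B i →⋆ₙₐ[ℂ] D) → Prop}
    {E : Type v} [NonUnitalCStarAlgebra E] (φ : UnivCStar B R →⋆ₙₐ[ℂ] E) {c : E}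
    (h : ∀ i b, Commute (φ (UnivCStar.gen B R i b)) c) (x : UnivCStar B R) :
    Commute (φ x) c := by
  -- The commutant of a single element need not be closed under `star`; the strengthened statement
  -- is, and it holds on the copies because their ranges are self-adjoint.
  suffices Commute (φ x) c ∧ Commute (φ (star x)) c from this.1
  have hφ := φ.continuous_of_cstar
  induction x using UnivCStar.induction with
  | hgen i b => exact ⟨h i b, by rw [← map_star]; exact h i (star b)⟩
  | hadd x y hx hy =>
    rw [star_add, map_add, map_add]
    exact ⟨hx.1.add_left hy.1, hx.2.add_left hy.2⟩
  | hmul x y hx hy =>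
    rw [star_mul, map_mul, map_mul]
    exact ⟨hx.1.mul_left hy.1, hy.2.mul_left hx.2⟩
  | hsmul r x hx =>
    rw [star_smul, map_smul, map_smul]
    exact ⟨hx.1.smul_left r, hx.2.smul_left _⟩
  | hstar x hx => rw [star_star]; exact hx.symm
  | hzero => simp
  | hcl =>
    exact (isClosed_eq (by fun_prop) (by fun_prop)).inter (isClosed_eq (by fun_prop) (by fun_prop))

namespace InfTensorPower

variable {P : Type u} [CStarAlgebra P] {E E' : Type u} [NonUnitalCStarAlgebra E]
  [NonUnitalCStarAlgebra E']

/-- The ⋆-homomorphism out of the infinite tensor power given by commuting copies of `P` with a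
common unit. -/
noncomputable def lift (g : ℕ → P →⋆ₙₐ[ℂ] E)
    (hg : ∀ k l, k ≠ l → ∀ p q, Commute (g k p) (g l q)) (h1 : ∀ k l, g k 1 = g l 1) :
    InfTensorPower P →⋆ₙₐ[ℂ] E :=
  UnivCStar.lift g ⟨hg, h1⟩

theorem lift_copy (g : ℕ → P →⋆ₙₐ[ℂ] E)
    (hg : ∀ k l, k ≠ l → ∀ p q, Commute (g k p) (g l q)) (h1 : ∀ k l, g k 1 = g l 1)
    (k : ℕ) (p : P) : lift g hg h1 (copy P k p) = g k p :=
  UnivCStar.lift_gen (B := fun _ : ℕ => P) (R := CommutingWithCommonUnit _) g ⟨hg, h1⟩ k p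

theorem hom_ext {φ ψ : InfTensorPower P →⋆ₙₐ[ℂ] E}
    (h : ∀ k p, φ (copy P k p) = ψ (copy P k p)) : φ = ψ :=
  UnivCStar.hom_ext h

theorem commute_of_commute_copy (φ : InfTensorPower P →⋆ₙₐ[ℂ] E) {c : E}
    (h : ∀ k p, Commute (φ (copy P k p)) c) (x : InfTensorPower P) : Commute (φ x) c :=
  UnivCStar.commute_of_commute_gen φ h x

theorem symm_one (s : InfTensorPower P ≃⋆ₐ[ℂ] P) (k : ℕ) : s.symm 1 = copy P k 1 :=
  EquivLike.injective s (by rw [StarAlgEquiv.apply_symm_apply, map_copy_one])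

end InfTensorPower

namespace WithCopies

variable {A P : Type u} [CStarAlgebra A] [CStarAlgebra P] {κ : Type}
  {E E' : Type u} [NonUnitalCStarAlgebra E] [NonUnitalCStarAlgebra E']

theorem CommuteOn.mono {S S' : Set κ} (hS : S' ⊆ S) {f : A →⋆ₙₐ[ℂ] E} {g : κ → P →⋆ₙₐ[ℂ] E}
    (h : CommuteOn S f g) : CommuteOn S' f g where
  base k hk := h.base k (hS hk)
  copies k hk l hl := h.copies k (hS hk) l (hS hl)
  unit k hk := h.unit k (hS hk)

namespace Tensor

theorem commute_of_commute_gen (φ : Tensor A P κ →⋆ₙₐ[ℂ] E) {c : E}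
    (h : ∀ a, Commute (φ (base A P a)) c) (h' : ∀ k p, Commute (φ (copy A P k p)) c)
    (x : Tensor A P κ) : Commute (φ x) c :=
  UnivCStar.commute_of_commute_gen φ (fun i b => match i, b with
    | none, b => h b
    | some k, b => h' k b) x

theorem commute_base (k : κ) (a : A) (p : P) : Commute (base A P a) (copy A P k p) :=
  commuteOn.base k trivial a p

theorem commute_copy {k l : κ} (h : k ≠ l) (p q : P) : Commute (copy A P k p) (copy A P l q) :=
  commuteOn.copies k trivial l trivial h p q

theorem copy_one (k : κ) : copy A P k 1 = base A P 1 := commuteOn.unit k trivial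

theorem map_base_one (r : Tensor A P κ ≃⋆ₐ[ℂ] A) : r (base A P 1) = 1 := by
  have h := congrArg r (base_one_mul (r.symm 1))
  rw [map_mul, StarAlgEquiv.apply_symm_apply, mul_one] at h
  exact h

theorem symm_one (r : Tensor A P κ ≃⋆ₐ[ℂ] A) : r.symm 1 = base A P 1 :=
  EquivLike.injective r (by rw [StarAlgEquiv.apply_symm_apply, map_base_one])

end Tensor

/-! ### The isomorphism `A ⊗ P^∞ ≅ A` -/

section Absorb

variable (s : InfTensorPower P ≃⋆ₐ[ℂ] P) (e : Tensor A P Unit ≃⋆ₐ[ℂ] A)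

variable (A) in
/-- The map `A ⊗ P^∞ → A ⊗ P`. -/
noncomputable def collapse : Tensor A P ℕ →⋆ₙₐ[ℂ] Tensor A P Unit :=
  Tensor.lift (Tensor.base A P)
    (fun k => (Tensor.copy A P ()).comp
      ((s : InfTensorPower P →⋆ₙₐ[ℂ] P).comp (InfTensorPower.copy P k)))
    { base := fun _ _ a _ => Tensor.commute_base () a _
      copies := fun _ _ _ _ hkl p q => ((InfTensorPower.commute hkl p q).map s).map
        (Tensor.copy A P ())
      unit := fun k _ => (congrArg (Tensor.copy A P ()) (InfTensorPower.map_copy_one s k)).trans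
        (Tensor.copy_one ()) }

theorem collapse_base (a : A) : collapse A s (Tensor.base A P a) = Tensor.base A P a :=
  Tensor.lift_base _ a

theorem collapse_copy (k : ℕ) (p : P) : collapse A s (Tensor.copy A P k p)
    = Tensor.copy A P () (s (InfTensorPower.copy P k p)) :=
  Tensor.lift_copy _ k p

variable (A P) in
/-- The canonical map `P^∞ → A ⊗ P^∞`. -/
noncomputable def powerToTensor : InfTensorPower P →⋆ₙₐ[ℂ] Tensor A P ℕ :=
  InfTensorPower.lift (Tensor.copy A P) (fun _ _ h => Tensor.commute_copy h)
    fun k l => (Tensor.copy_one k).trans (Tensor.copy_one l).symm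

theorem powerToTensor_copy (k : ℕ) (p : P) :
    powerToTensor A P (InfTensorPower.copy P k p) = Tensor.copy A P k p :=
  InfTensorPower.lift_copy _ _ _ k p

variable (A) in
/-- The map `A ⊗ P → A ⊗ P^∞`. -/
noncomputable def expand : Tensor A P Unit →⋆ₙₐ[ℂ] Tensor A P ℕ :=
  Tensor.lift (Tensor.base A P)
    (fun _ => (powerToTensor A P).comp (s.symm : P →⋆ₙₐ[ℂ] InfTensorPower P))
    { base := fun _ _ a _ => (InfTensorPower.commute_of_commute_copy (powerToTensor A P)
        (fun k p => by
          rw [powerToTensor_copy]; exact (Tensor.commute_base k a p).symm) _).symm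
      copies := fun _ _ _ _ h => absurd rfl h
      unit := fun _ _ => by
        change powerToTensor A P (s.symm 1) = _
        -- The index `0` is arbitrary, since all copies share one unit.
        rw [InfTensorPower.symm_one s 0, powerToTensor_copy, Tensor.copy_one] }

theorem expand_base (a : A) : expand A s (Tensor.base A P a) = Tensor.base A P a :=
  Tensor.lift_base _ a

theorem expand_copy (k : Unit) (x : InfTensorPower P) :
    expand A s (Tensor.copy A P k (s x)) = powerToTensor A P x :=
  (Tensor.lift_copy _ k (s x)).trans (congrArg (powerToTensor A P) (s.symm_apply_apply x))

theorem expand_collapse (x : Tensor A P ℕ) : expand A s (collapse A s x) = x := by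
  change ((expand A s).comp (collapse A s)) x = NonUnitalStarAlgHom.id ℂ _ x
  congr 1
  refine Tensor.hom_ext (fun a => ?_) fun k p => ?_
  · rw [NonUnitalStarAlgHom.comp_apply, collapse_base, expand_base]; rfl
  · rw [NonUnitalStarAlgHom.comp_apply, collapse_copy, expand_copy, powerToTensor_copy]; rfl

theorem collapse_powerToTensor (x : InfTensorPower P) :
    collapse A s (powerToTensor A P x) = Tensor.copy A P () (s x) := by
  change ((collapse A s).comp (powerToTensor A P)) x
    = ((Tensor.copy A P ()).comp (s : InfTensorPower P →⋆ₙₐ[ℂ] P)) x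
  congr 1
  refine InfTensorPower.hom_ext fun j p => ?_
  rw [NonUnitalStarAlgHom.comp_apply, powerToTensor_copy, collapse_copy]; rfl

theorem collapse_expand (x : Tensor A P Unit) : collapse A s (expand A s x) = x := by
  change ((collapse A s).comp (expand A s)) x = NonUnitalStarAlgHom.id ℂ _ x
  congr 1
  refine Tensor.hom_ext (fun a => ?_) fun k p => ?_
  · rw [NonUnitalStarAlgHom.comp_apply, expand_base, collapse_base]; rfl
  · obtain ⟨q, rfl⟩ := EquivLike.surjective s p
    rw [NonUnitalStarAlgHom.comp_apply, expand_copy, collapse_powerToTensor]; rfl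

/-- `A ⊗ P^∞ ≅ A` if `A ⊗ P ≅ A` and `P^∞ ≅ P`. -/
noncomputable def absorbEquiv : Tensor A P ℕ ≃⋆ₐ[ℂ] A :=
  { (e : Tensor A P Unit →⋆ₙₐ[ℂ] A).comp (collapse A s) with
    invFun := fun a => expand A s (e.symm a)
    left_inv := fun x =>
      (congrArg (expand A s) (e.symm_apply_apply _)).trans (expand_collapse s x)
    right_inv := fun a =>
      (congrArg e (collapse_expand s _)).trans (e.apply_symm_apply a) }

end Absorb

/-! ### Absorbing the first `k` copies into `A` and the tail into one copy -/

section Spread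

variable (r : Tensor A P ℕ ≃⋆ₐ[ℂ] A) (s : InfTensorPower P ≃⋆ₐ[ℂ] P) (k m : ℕ)

variable (A P) in
/-- The endomorphism of `A ⊗ P^∞` shifting the copies of `P` by `k`. -/
noncomputable def shift : Tensor A P ℕ →⋆ₙₐ[ℂ] Tensor A P ℕ :=
  Tensor.lift (Tensor.base A P) (fun j => Tensor.copy A P (k + j))
    { base := fun _ _ => Tensor.commute_base _
      copies := fun _ _ _ _ h => Tensor.commute_copy fun e => h (Nat.add_left_cancel e)
      unit := fun _ _ => Tensor.copy_one _ }

theorem commute_shift {j : ℕ} (hj : j < k) (x : Tensor A P ℕ) (p : P) :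
    Commute (shift A P k x) (Tensor.copy A P j p) := by
  refine Tensor.commute_of_commute_gen _ (fun a => ?_) (fun i q => ?_) x
  · rw [shift, Tensor.lift_base]; exact Tensor.commute_base _ _ _
  · rw [shift, Tensor.lift_copy]; exact Tensor.commute_copy (by omega) _ _

/-- The copy of `A` in the decomposition `A ≅ A ⊗ P^k`. -/
noncomputable def innerBase : A →⋆ₙₐ[ℂ] A :=
  (r : Tensor A P ℕ →⋆ₙₐ[ℂ] A).comp ((shift A P k).comp (r.symm : A →⋆ₙₐ[ℂ] Tensor A P ℕ))

/-- The copies of `P` in the decomposition `A ≅ A ⊗ P^k`. -/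
noncomputable def innerCopy (j : ℕ) : P →⋆ₙₐ[ℂ] A :=
  (r : Tensor A P ℕ →⋆ₙₐ[ℂ] A).comp (Tensor.copy A P j)

theorem innerBase_one : innerBase r k 1 = 1 := by
  change r (shift A P k (r.symm 1)) = 1
  rw [Tensor.symm_one, shift, Tensor.lift_base, Tensor.map_base_one]

theorem innerCopy_one (j : ℕ) : innerCopy r j 1 = 1 := by
  change r (Tensor.copy A P j 1) = 1
  rw [Tensor.copy_one, Tensor.map_base_one]

/-- The shift vacates the first `k` tensor positions, which the inner copies of `P` then occupy.
Thus the relations with `k` copies are realised within `A` itself. -/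
theorem commuteOn_inner : CommuteOn {j | j < k} (innerBase r k) (innerCopy r) where
  base _ hj a p := (commute_shift k hj (r.symm a) p).map r
  copies _ _ _ _ h p q := (Tensor.commute_copy h p q).map r
  unit j _ := by rw [innerBase_one, innerCopy_one]

/-- Given ⋆-homomorphisms on `A` and `m + 1` copies of `P`, the ⋆-homomorphisms on infinitely many
copies of `P` sending the first `k` into `A`, the next `m` to the first `m` copies, and the
remaining ones into the last copy. -/
noncomputable def spreadCopy (f : A →⋆ₙₐ[ℂ] E) (g : Fin (m + 1) → P →⋆ₙₐ[ℂ] E) (j : ℕ) :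
    P →⋆ₙₐ[ℂ] E :=
  if j < k then f.comp (innerCopy r j)
  else if h : j - k < m then g (Fin.castSucc ⟨j - k, h⟩)
  else (g (Fin.last m)).comp
    ((s : InfTensorPower P →⋆ₙₐ[ℂ] P).comp (InfTensorPower.copy P (j - k - m)))

/-- Naturality in the target; it identifies the spread family in the free product, pushed down by
the quotient map, with the spread family in the tensor product. -/
theorem comp_spreadCopy (f : A →⋆ₙₐ[ℂ] E) (g : Fin (m + 1) → P →⋆ₙₐ[ℂ] E) (φ : E →⋆ₙₐ[ℂ] E')
    (j : ℕ) : φ.comp (spreadCopy r s k m f g j)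
      = spreadCopy r s k m (φ.comp f) (fun i => φ.comp (g i)) j := by
  unfold spreadCopy
  split_ifs <;> rfl

theorem spreadCopy_of_lt {j : ℕ} (hj : j < k) (f : A →⋆ₙₐ[ℂ] E) (g : Fin (m + 1) → P →⋆ₙₐ[ℂ] E) :
    spreadCopy r s k m f g j = f.comp (innerCopy r j) := if_pos hj

theorem spreadCopy_add (i : Fin m) (f : A →⋆ₙₐ[ℂ] E) (g : Fin (m + 1) → P →⋆ₙₐ[ℂ] E) :
    spreadCopy r s k m f g (k + i) = g i.castSucc := by
  have h : k + (i : ℕ) - k = i := Nat.add_sub_cancel_left _ _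
  rw [spreadCopy, if_neg (by omega), dif_pos (by omega)]
  simp only [h]

theorem spreadCopy_add_add (j : ℕ) (f : A →⋆ₙₐ[ℂ] E) (g : Fin (m + 1) → P →⋆ₙₐ[ℂ] E) :
    spreadCopy r s k m f g (k + m + j) = (g (Fin.last m)).comp
      ((s : InfTensorPower P →⋆ₙₐ[ℂ] P).comp (InfTensorPower.copy P j)) := by
  rw [spreadCopy, if_neg (by omega), dif_neg (by omega), show k + m + j - k - m = j by omega]

/-- Everything involved factors through `f`, so the relations come from inside `A`. No compatibility
between `f` and `g` is required, which is why this applies to the free product. -/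
theorem commuteOn_spread_lt (f : A →⋆ₙₐ[ℂ] E) (g : Fin (m + 1) → P →⋆ₙₐ[ℂ] E) :
    CommuteOn {j | j < k} (f.comp (innerBase r k)) (spreadCopy r s k m f g) where
  base j hj a p := by
    rw [spreadCopy_of_lt r s k m hj]; exact ((commuteOn_inner r k).base j hj a p).map f
  copies i hi j hj h p q := by
    rw [spreadCopy_of_lt r s k m hi, spreadCopy_of_lt r s k m hj]
    exact ((commuteOn_inner r k).copies i hi j hj h p q).map f
  unit j hj := by
    rw [spreadCopy_of_lt r s k m hj]; exact congrArg f ((commuteOn_inner r k).unit j hj)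

theorem nat_cases (j : ℕ) :
    j < k ∨ (∃ i : Fin m, j = k + i) ∨ ∃ i, j = k + m + i := by
  by_cases h : j < k
  · exact .inl h
  by_cases h' : j < k + m
  · exact .inr (.inl ⟨⟨j - k, by omega⟩, by simp; omega⟩)
  · exact .inr (.inr ⟨j - (k + m), by omega⟩)

/-- The new cases beyond `commuteOn_spread_lt` are of two kinds: maps factoring through different
members of the original family, which commute by `h`, and two tail copies in the last `g`, which
commute already in `P^∞`. -/
theorem commuteOn_spread {f : A →⋆ₙₐ[ℂ] E} {g : Fin (m + 1) → P →⋆ₙₐ[ℂ] E}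
    (h : CommuteOn Set.univ f g) :
    CommuteOn Set.univ (f.comp (innerBase r k)) (spreadCopy r s k m f g) := by
  have hlt := commuteOn_spread_lt r s k m f g
  -- Proved for all of `A` and not only for the inner copy, so that it also covers the first `k`
  -- copies of `P`, whose images lie in the range of `f`.
  have hbase : ∀ j, k ≤ j → ∀ a p, Commute (f a) (spreadCopy r s k m f g j p) := by
    intro j hj a p
    obtain hj' | ⟨i, rfl⟩ | ⟨i, rfl⟩ := nat_cases k m j
    · omega
    · rw [spreadCopy_add]; exact h.base _ trivial _ _
    · rw [spreadCopy_add_add]; exact h.base _ trivial _ _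
  have hcopies : ∀ i j, i < j → ∀ p q,
      Commute (spreadCopy r s k m f g i p) (spreadCopy r s k m f g j q) := by
    intro i j hij p q
    by_cases hjk : j < k
    · exact hlt.copies i (hij.trans hjk) j hjk hij.ne p q
    obtain hi | ⟨i, rfl⟩ | ⟨i, rfl⟩ := nat_cases k m i
    · rw [spreadCopy_of_lt r s k m hi]; exact hbase j (by omega) _ _
    · rw [spreadCopy_add]
      obtain hj | ⟨j, rfl⟩ | ⟨j, rfl⟩ := nat_cases k m j
      · exact absurd hj hjk
      · rw [spreadCopy_add]
        refine h.copies _ trivial _ trivial (fun e => ?_) _ _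
        have := Fin.castSucc_injective m e
        subst this
        omega
      · rw [spreadCopy_add_add]
        exact h.copies _ trivial _ trivial (Fin.castSucc_lt_last i).ne _ _
    -- The smaller index is already in the tail, hence so is the larger one.
    · obtain ⟨j, rfl⟩ : ∃ j', j = k + m + j' := ⟨j - (k + m), by omega⟩
      rw [spreadCopy_add_add, spreadCopy_add_add]
      exact ((InfTensorPower.commute (by omega) p q).map s).map (g (Fin.last m))
  refine ⟨fun j _ a p => ?_, fun i _ j _ hij p q => ?_, fun j _ => ?_⟩
  · by_cases hj : j < k
    · exact hlt.base j hj a p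
    · exact hbase j (by omega) _ _
  · rcases lt_or_gt_of_ne hij with hij | hij
    · exact hcopies i j hij p q
    · exact (hcopies j i hij q p).symm
  · rw [NonUnitalStarAlgHom.comp_apply, innerBase_one]
    obtain hj | ⟨i, rfl⟩ | ⟨i, rfl⟩ := nat_cases k m j
    · rw [spreadCopy_of_lt r s k m hj, NonUnitalStarAlgHom.comp_apply, innerCopy_one]
    · rw [spreadCopy_add]; exact h.unit _ trivial
    · rw [spreadCopy_add_add]
      exact (congrArg _ (InfTensorPower.map_copy_one s i)).trans (h.unit _ trivial)

/-- The map `A ⊗ P^∞ → A ⊗ P^(m+1)` absorbing the first `k` copies of `P` into `A` and all but the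
next `m` into the last copy. -/
noncomputable def regroup : Tensor A P ℕ →⋆ₙₐ[ℂ] Tensor A P (Fin (m + 1)) :=
  Tensor.lift _ _ (commuteOn_spread r s k m Tensor.commuteOn)

/-! ### Undoing the regrouping -/

/-- The isomorphism `A ⊗ P^∞ ≅ (A ⊗ P^∞) ⊗ P^k ≅ A ⊗ P^k`, followed by the inclusion into
`A ⊗ P^∞` on the first `k` copies. -/
noncomputable def splitOff : Tensor A P ℕ →⋆ₙₐ[ℂ] Tensor A P ℕ :=
  Tensor.lift ((Tensor.base A P).comp ((r : Tensor A P ℕ →⋆ₙₐ[ℂ] A).comp (Tensor.base A P)))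
    (fun j => if j < k then Tensor.copy A P j else (Tensor.base A P).comp (innerCopy r (j - k)))
    { base := fun j _ a p => by
        split_ifs
        · exact Tensor.commute_base _ _ _
        · exact ((Tensor.commute_base _ _ _).map r).map (Tensor.base A P)
      copies := fun i _ j _ hij p q => by
        split_ifs
        · exact Tensor.commute_copy hij _ _
        · exact (Tensor.commute_base _ _ _).symm
        · exact Tensor.commute_base _ _ _
        · exact ((Tensor.commute_copy (by omega) _ _).map r).map (Tensor.base A P)
      unit := fun j _ => by
        have h : ((Tensor.base A P (κ := ℕ)).comp
            ((r : Tensor A P ℕ →⋆ₙₐ[ℂ] A).comp (Tensor.base A P))) 1 = Tensor.base A P 1 :=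
          congrArg (Tensor.base A P) (Tensor.map_base_one r)
        rw [h]
        split_ifs
        · exact Tensor.copy_one _
        · exact congrArg (Tensor.base A P) (innerCopy_one r _) }

/-- The image of `splitOff` involves only `A` and the first `k` copies, which leaves the positions
from `k` on free for the copies of `P` in `ungroup`. -/
theorem commute_splitOff {j : ℕ} (hj : k ≤ j) (x : Tensor A P ℕ) (p : P) :
    Commute (splitOff r k x) (Tensor.copy A P j p) := by
  refine Tensor.commute_of_commute_gen _ (fun a => ?_) (fun i q => ?_) x
  · rw [splitOff, Tensor.lift_base]; exact Tensor.commute_base _ _ _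
  · rw [splitOff, Tensor.lift_copy]
    split_ifs
    · exact Tensor.commute_copy (by omega) _ _
    · exact Tensor.commute_base _ _ _

theorem splitOff_symm_one : splitOff r k (r.symm 1) = Tensor.base A P 1 := by
  rw [Tensor.symm_one, splitOff, Tensor.lift_base]
  exact congrArg (Tensor.base A P) (Tensor.map_base_one r)

/-- On the tensor factor `A`, regrouping acts through `r` as the shift by `k`. It therefore moves
the copies that `splitOff` lowered by `k` back to their places, while the first `k` copies are
absorbed by `r` at their own positions. -/
theorem regroup_splitOff (x : Tensor A P ℕ) :
    regroup r s k m (splitOff r k x) = Tensor.base A P (r x) := by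
  change ((regroup r s k m).comp (splitOff r k)) x
    = ((Tensor.base A P).comp (r : Tensor A P ℕ →⋆ₙₐ[ℂ] A)) x
  congr 1
  have hinner : ∀ y, regroup r s k m (Tensor.base A P (r y)) = Tensor.base A P (r (shift A P k y)) :=
    fun y => by
      rw [regroup, Tensor.lift_base]
      change Tensor.base A P (r (shift A P k (r.symm (r y)))) = _
      rw [StarAlgEquiv.symm_apply_apply]
  refine Tensor.hom_ext (fun a => ?_) fun j p => ?_
  · rw [NonUnitalStarAlgHom.comp_apply, splitOff, Tensor.lift_base]
    refine (hinner (Tensor.base A P a)).trans ?_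
    rw [shift, Tensor.lift_base]; rfl
  · rw [NonUnitalStarAlgHom.comp_apply, splitOff, Tensor.lift_copy]
    split_ifs with h
    · rw [regroup, Tensor.lift_copy, spreadCopy_of_lt r s k m h]; rfl
    · refine (hinner (Tensor.copy A P (j - k) p)).trans ?_
      rw [shift, Tensor.lift_copy, Nat.add_sub_cancel' (Nat.le_of_not_lt h)]; rfl

/-- The infinite tensor power onto the copies of `P` from `k` on. -/
noncomputable def tail : InfTensorPower P →⋆ₙₐ[ℂ] Tensor A P ℕ :=
  (shift A P k).comp (powerToTensor A P)

theorem tail_copy (j : ℕ) (p : P) :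
    tail k (InfTensorPower.copy P j p) = Tensor.copy A P (k + j) p := by
  rw [tail, NonUnitalStarAlgHom.comp_apply, powerToTensor_copy, shift, Tensor.lift_copy]

theorem commute_tail {c : Tensor A P ℕ}
    (h : ∀ j, k ≤ j → ∀ p, Commute c (Tensor.copy A P j p)) (x : InfTensorPower P) :
    Commute c (tail k x) :=
  (InfTensorPower.commute_of_commute_copy (tail k) (fun j p => by
    rw [tail_copy]; exact (h _ (Nat.le_add_right k j) p).symm) x).symm

/-- The copies of `P` for `ungroup`. -/
noncomputable def ungroupCopy (i : Fin (m + 1)) : P →⋆ₙₐ[ℂ] Tensor A P ℕ :=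
  Fin.lastCases (motive := fun _ => P →⋆ₙₐ[ℂ] Tensor A P ℕ)
    ((tail (k + m)).comp (s.symm : P →⋆ₙₐ[ℂ] InfTensorPower P))
    (fun i => Tensor.copy A P (k + i)) i

theorem ungroupCopy_last : ungroupCopy (A := A) s k m (Fin.last m)
    = (tail (k + m)).comp (s.symm : P →⋆ₙₐ[ℂ] InfTensorPower P) := Fin.lastCases_last

theorem ungroupCopy_castSucc (i : Fin m) :
    ungroupCopy s k m i.castSucc = Tensor.copy A P (k + i) := Fin.lastCases_castSucc i

/-- The three pieces sit on disjoint positions: `A` uses the base and the copies below `k`, the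
first `m` copies use those from `k` to `k + m - 1`, and the last one uses the tail from `k + m` on.
-/
theorem commuteOn_ungroup : CommuteOn Set.univ
    ((splitOff r k).comp (r.symm : A →⋆ₙₐ[ℂ] Tensor A P ℕ)) (ungroupCopy s k m) := by
  have hlast : ∀ (i : Fin m) (p q : P), Commute (ungroupCopy (A := A) s k m i.castSucc p)
      (ungroupCopy s k m (Fin.last m) q) := fun i p q => by
    rw [ungroupCopy_last, ungroupCopy_castSucc]
    exact commute_tail _ (fun j hj p => Tensor.commute_copy (by omega) _ _) _
  refine ⟨fun i _ a p => ?_, fun i _ j _ hij p q => ?_, fun i _ => ?_⟩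
  · cases i using Fin.lastCases with
    | last =>
      rw [ungroupCopy_last]
      exact commute_tail _ (fun j hj p => commute_splitOff r k (by omega) _ p) _
    | cast i =>
      rw [ungroupCopy_castSucc]
      exact commute_splitOff r k (by omega) _ p
  · cases i using Fin.lastCases with
    | last =>
      cases j using Fin.lastCases with
      | last => exact absurd rfl hij
      | cast j => exact (hlast j q p).symm
    | cast i =>
      cases j using Fin.lastCases with
      | last => exact hlast i p q
      | cast j =>
        rw [ungroupCopy_castSucc, ungroupCopy_castSucc]
        refine Tensor.commute_copy (fun e => hij ?_) _ _
        rw [Fin.ext (Nat.add_left_cancel e)]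
  · refine Eq.trans ?_ (splitOff_symm_one r k).symm
    cases i using Fin.lastCases with
    | last =>
      rw [ungroupCopy_last]
      change tail (k + m) (s.symm 1) = _
      rw [InfTensorPower.symm_one s 0, tail_copy, Tensor.copy_one]
    | cast i => rw [ungroupCopy_castSucc, Tensor.copy_one]

/-- A right inverse of `regroup`. -/
noncomputable def ungroup : Tensor A P (Fin (m + 1)) →⋆ₙₐ[ℂ] Tensor A P ℕ :=
  Tensor.lift _ _ (commuteOn_ungroup r s k m)

theorem regroup_ungroup (x : Tensor A P (Fin (m + 1))) :
    regroup r s k m (ungroup r s k m x) = x := by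
  change ((regroup r s k m).comp (ungroup r s k m)) x = NonUnitalStarAlgHom.id ℂ _ x
  congr 1
  refine Tensor.hom_ext (fun a => ?_) fun i p => ?_
  · rw [NonUnitalStarAlgHom.comp_apply, ungroup, Tensor.lift_base]
    refine (regroup_splitOff r s k m _).trans ?_
    exact congrArg (Tensor.base A P) (r.apply_symm_apply a)
  · rw [NonUnitalStarAlgHom.comp_apply, ungroup, Tensor.lift_copy]
    cases i using Fin.lastCases with
    | last =>
      rw [ungroupCopy_last]
      -- Writing `p` as the image of an element of `P^∞` reduces the claim to the generating copies
      -- of the tail.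
      obtain ⟨q, rfl⟩ := EquivLike.surjective s p
      change regroup r s k m (tail (k + m) (s.symm (s q))) = _
      rw [StarAlgEquiv.symm_apply_apply]
      change ((regroup r s k m).comp (tail (k + m))) q
        = ((Tensor.copy A P (Fin.last m)).comp (s : InfTensorPower P →⋆ₙₐ[ℂ] P)) q
      congr 1
      refine InfTensorPower.hom_ext fun j p => ?_
      rw [NonUnitalStarAlgHom.comp_apply, tail_copy, regroup, Tensor.lift_copy, spreadCopy_add_add]
      rfl
    | cast i =>
      rw [ungroupCopy_castSucc, regroup, Tensor.lift_copy, spreadCopy_add]; rfl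

end Spread

/-! ### The ideals of tensor relations and the lifting argument -/

section Splitting

variable (A P) in
/-- The ideal of the infinite free product corresponding to the relations of the tensor product
between `A` and the first `k` copies of `P`. -/
noncomputable def relIdeal (k : ℕ) : ClosedIdeal (Free A P ℕ) :=
  commonKernel _ fun _ _ f =>
    CommuteOn {j | j < k} (f.comp (Free.base A P)) fun j => f.comp (Free.copy A P j)

theorem relIdeal_mono (k l : ℕ) (h : k ≤ l) :
    (relIdeal A P k).toSubmodule ≤ (relIdeal A P l).toSubmodule :=
  fun _ hx E _ f hf => hx E f (hf.mono fun _ hj => lt_of_lt_of_le hj h)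

variable (A P) in
/-- The ideal corresponding to all the relations of the tensor product. -/
noncomputable def relIdealTop : ClosedIdeal (Free A P ℕ) :=
  ClosedIdeal.closureUnion (relIdeal A P) relIdeal_mono

variable (A P) in
theorem coe_relIdealTop : ((relIdealTop A P).toSubmodule : Set (Free A P ℕ))
    = closure (⋃ k, ((relIdeal A P k).toSubmodule : Set (Free A P ℕ))) :=
  ClosedIdeal.coe_closureUnion _ _

theorem proj_eq_of_mem {k : ℕ} {x y : Free A P ℕ} (h : x - y ∈ (relIdeal A P k).toSubmodule) :
    (relIdealTop A P).proj x = (relIdealTop A P).proj y :=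
  ClosedIdeal.proj_eq_iff _ |>.mpr (ClosedIdeal.le_of_closure (coe_relIdealTop A P) k h)

-- Each single relation involves finitely many copies, hence holds modulo some member of the
-- increasing sequence of ideals.
variable (A P) in
theorem commuteOn_proj : CommuteOn Set.univ ((relIdealTop A P).proj.comp (Free.base A P))
    fun j => (relIdealTop A P).proj.comp (Free.copy A P j) where
  base j _ a p := by
    change _ * _ = _ * _
    simp only [NonUnitalStarAlgHom.comp_apply, ← map_mul]
    -- Any bound exceeding both `i` and `j` would do.
    refine proj_eq_of_mem (k := j + 1) fun E _ f hf => ?_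
    rw [map_sub, map_mul, map_mul, sub_eq_zero]
    exact hf.base j (Nat.lt_succ_self j) a p
  copies i _ j _ hij p q := by
    change _ * _ = _ * _
    simp only [NonUnitalStarAlgHom.comp_apply, ← map_mul]
    refine proj_eq_of_mem (k := i + j + 1) fun E _ f hf => ?_
    rw [map_sub, map_mul, map_mul, sub_eq_zero]
    exact hf.copies i (show i < i + j + 1 by omega) j (show j < i + j + 1 by omega) hij p q
  unit j _ := by
    refine proj_eq_of_mem (k := j + 1) fun E _ f hf => ?_
    rw [map_sub, sub_eq_zero]
    exact hf.unit j (Nat.lt_succ_self j)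

/-- Satisfying all relations implies satisfying the first `k` for every `k`, so `f` vanishes on the
union, and by continuity on its closure. -/
theorem eq_zero_of_mem_relIdealTop {f : Free A P ℕ →⋆ₙₐ[ℂ] E}
    (hf : CommuteOn Set.univ (f.comp (Free.base A P)) fun j => f.comp (Free.copy A P j))
    (x : Free A P ℕ) (hx : x ∈ (relIdealTop A P).toSubmodule) : f x = 0 := by
  rw [← SetLike.mem_coe, coe_relIdealTop] at hx
  have hcl : IsClosed {y | f y = 0} := isClosed_eq f.continuous_of_cstar continuous_const
  refine closure_minimal (Set.iUnion_subset fun k y hy => ?_) hcl hx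
  exact hy E f (hf.mono (Set.subset_univ _))

theorem exists_splitting (hA : IsSemiprojective A) (r : Tensor A P ℕ ≃⋆ₐ[ℂ] A)
    (s : InfTensorPower P ≃⋆ₐ[ℂ] P) (m : ℕ) :
    ∃ σ : Tensor A P (Fin (m + 1)) →⋆ₙₐ[ℂ] Free A P (Fin (m + 1)),
      (freeToTensor (WithCopies A P (Fin (m + 1)))).comp σ = NonUnitalStarAlgHom.id ℂ _ := by
  -- Only this direction of the identification of the quotient with `A ⊗ P^∞` is needed.
  let φ : Tensor A P ℕ →⋆ₙₐ[ℂ] (relIdealTop A P).Quotient := Tensor.lift _ _ (commuteOn_proj A P)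
  obtain ⟨k, ψ, hψ⟩ := hA _ (relIdeal A P) (relIdealTop A P) relIdeal_mono (coe_relIdealTop A P)
    (φ.comp (r.symm : A →⋆ₙₐ[ℂ] Tensor A P ℕ))
  let π := freeToTensor (WithCopies A P (Fin (m + 1)))
  -- The target is free, so `h` can be defined only after semiprojectivity has fixed `k`: it hides
  -- exactly the relations of the first `k` copies inside `A`.
  let h : Free A P ℕ →⋆ₙₐ[ℂ] Free A P (Fin (m + 1)) :=
    Free.lift ((Free.base A P).comp (innerBase r k))
      (spreadCopy r s k m (Free.base A P) (Free.copy A P))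
  have hbase : h.comp (Free.base A P) = (Free.base A P).comp (innerBase r k) := by
    ext a; exact Free.lift_base _ _ a
  have hcopy : ∀ j, h.comp (Free.copy A P j)
      = spreadCopy r s k m (Free.base A P) (Free.copy A P) j := fun j => by
    ext p; exact Free.lift_copy _ _ j p
  have hπbase : (π.comp h).comp (Free.base A P) = (Tensor.base A P).comp (innerBase r k) := by
    ext a
    change π (h.comp (Free.base A P) a) = _
    rw [hbase]; exact freeToTensor_base _
  have hπcopy : ∀ j, (π.comp h).comp (Free.copy A P j)
      = spreadCopy r s k m (Tensor.base A P) (Tensor.copy A P) j := fun j => by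
    change π.comp (h.comp (Free.copy A P j)) = _
    rw [hcopy, comp_spreadCopy]
    congr 1
    · ext a; exact freeToTensor_base a
    · ext i p; exact freeToTensor_copy i p
  have hk : ∀ x ∈ (relIdeal A P k).toSubmodule, h x = 0 := fun x hx => hx _ h (by
    simp only [hbase, hcopy]; exact commuteOn_spread_lt r s k m _ _)
  have htop : ∀ x ∈ (relIdealTop A P).toSubmodule, π.comp h x = 0 :=
    eq_zero_of_mem_relIdealTop (by
      simp only [hπbase, hπcopy]; exact commuteOn_spread r s k m Tensor.commuteOn)
  let H := (relIdeal A P k).liftQuotient h hk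
  let G := (relIdealTop A P).liftQuotient (π.comp h) htop
  -- After `π`, the map no longer depends on the lift `ψ`, only on its class modulo the full ideal,
  -- which `hψ` determines.
  have hG : ∀ y, π (H y) = G (ClosedIdeal.factor
      (ClosedIdeal.le_of_closure (coe_relIdealTop A P) k) y) := fun y => by
    obtain ⟨x, rfl⟩ := ClosedIdeal.proj_surjective _ y
    rfl
  have hGφ : G.comp φ = regroup r s k m := by
    refine Tensor.hom_ext (fun a => ?_) fun j p => ?_
    · rw [NonUnitalStarAlgHom.comp_apply, Tensor.lift_base, regroup, Tensor.lift_base]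
      exact DFunLike.congr_fun hπbase a
    · rw [NonUnitalStarAlgHom.comp_apply, Tensor.lift_copy, regroup, Tensor.lift_copy]
      exact DFunLike.congr_fun (hπcopy j) p
  refine ⟨H.comp (ψ.comp ((r : Tensor A P ℕ →⋆ₙₐ[ℂ] A).comp (ungroup r s k m))), ?_⟩
  ext x
  change π (H (ψ (r (ungroup r s k m x)))) = x
  rw [hG, hψ]
  change G (φ (r.symm (r (ungroup r s k m x)))) = x
  rw [StarAlgEquiv.symm_apply_apply]
  exact (DFunLike.congr_fun hGφ _).trans (regroup_ungroup r s k m x)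

end Splitting

end WithCopies

theorem mainTheorem5 (A P : Type u) [CStarAlgebra A] [CStarAlgebra P]
    [TopologicalSpace.SeparableSpace A] [TopologicalSpace.SeparableSpace P]
    (hP : Nonempty (P ≃⋆ₐ[ℂ] MaxTensorProduct fun _ : ℕ => P))
    (hA : IsSemiprojective A)
    (hAP : Nonempty (MaxTensorProduct (WithCopies A P Unit) ≃⋆ₐ[ℂ] A))
    (n : ℕ) (hn : 1 ≤ n) :
    ∃ σ : MaxTensorProduct (WithCopies A P (Fin n)) →⋆ₙₐ[ℂ]
        FullFreeProduct (WithCopies A P (Fin n)),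
      (freeToTensor (WithCopies A P (Fin n))).comp σ = NonUnitalStarAlgHom.id ℂ _ := by
  -- With `n ≥ 1` there is a last copy of `P` to absorb the infinite tail.
  obtain ⟨m, rfl⟩ : ∃ m, n = m + 1 := ⟨n - 1, by omega⟩
  obtain ⟨s⟩ := hP
  obtain ⟨e⟩ := hAP
  exact WithCopies.exists_splitting hA (WithCopies.absorbEquiv s.symm e) s.symm m
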